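/- Let $q\ge 1$. For a sequence $(s_j)_{j=0}^\infty$ of complex $q\times q$ matrices put $H_n=(s_{j+k})_{j,k=0}^n$ and $K_n=(s_{j+k+1})_{j,k=0}^n$; the sequence is called Stieltjes positive definite, $(s_j)_{j=0}^\infty\in\mathcal K^{>}_{q,\infty}$, if $H_n$ and $K_n$ are positive definite Hermitian for all $n\ge 0$. For such a sequence put $L_0=s_0$, $\hat L_0=s_1$ and, for $n\ge1$, $$L_n=s_{2n}-[s_n,\dots,s_{2n-1}]\,H_{n-1}^{-1}\begin{bmatrix}s_n\\ \vdots\\ s_{2n-1}\end{bmatrix},\qquad \hat L_n=s_{2n+1}-[s_{n+1},\dots,s_{2n}]\,K_{n-1}^{-1}\begin{bmatrix}s_{n+1}\\ \vdots\\ s_{2n}\end{bmatrix}.$$ Let $T_n=(\delta_{j,k+1}I_q)_{j,k=0}^n$, $R_n(z)=(I_{(n+1)q}-zT_n)^{-1}$, $u_n=[0;-s_0;\dots;-s_{n-1}]$ (block column with $n+1$ blocks), and define the matrix polynomials of the second kind by $Q_0(z)=0$, $Q^\sharp_0(z)=s_0$ and, for $n\ge1$, $$Q_n(z)=-u_n^*[R_n(\overline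 z)]^*\begin{bmatrix}-H_{n-1}^{-1}\begin{bmatrix}s_n\\ \vdots\\ s_{2n-1}\end{bmatrix}\\ I_q\end{bmatrix},\qquad Q^\sharp_n(z)=[s_0,\dots,s_n][R_n(\overline z)]^*\begin{bmatrix}-K_{n-1}^{-1}\begin{bmatrix}s_{n+1}\\ \vdots\\ s_{2n}\end{bmatrix}\\ I_q\end{bmatrix}.$$ The first transform of $(s_j)$ is $s^{(1)}_j=-s_0\,s^{\sharp}_{j+1}\,s_0$, where $s^\sharp_0=s_0^\dagger$ (Moore–Penrose inverse; here $s_0^\dagger=s_0^{-1}$) and $s^\sharp_j=-s_0^\dagger\sum_{l=0}^{j-1}s_{j-l}s^\sharp_l$ for $j\ge1$. A sequence $(P_k)_{k=0}^\infty$ of $q\times q$ matrix polynomials is a monic right orthogonal system with respect to a sequence $(t_j)_{j=0}^\infty$ if $P_k$ has degree $k$ and leading coefficient $I_q$ for all $k$, and, with $P_k(z)=\sum_i z^iA_{k,i}$ and $Y_n(P_k)=[A_{k,0};\dots;A_{k,n}]$, one has $Y_n(P_j)^*\,(t_{a+b})_{a,b=0}^n\,Y_n(P_k)=0$ for all $j\ne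 k$, where $n=\max\{j,k\}$. Let $\mathcal M[[0,\infty);(t_j)_{j=0}^\infty]$ be the set of all nonnegative Hermitian $q\times q$ measures $\sigma$ on the Borel sets of $[0,\infty)$ for which $\int_{[0,\infty)}t^j\,\sigma(dt)$ exists and equals $t_j$ for all $j\ge 0$. **Proposition.** Let $(s_j)_{j=0}^\infty\in\mathcal K^{>}_{q,\infty}$. Then $(s^{(1)}_j)_{j=0}^\infty$ and $(s^{(1)}_{j+1})_{j=0}^\infty$ both belong to $\mathcal K^{>}_{q,\infty}$. Furthermore, $(s_0^{-1}Q^\sharp_k)_{k=0}^\infty$ is a monic right orthogonal system with respect to $(s^{(1)}_j)_{j=0}^\infty$, and $(s_0^{-1}Q_{k+1})_{k=0}^\infty$ is a monic right orthogonal system with respect to $(s^{(1)}_{j+1})_{j=0}^\infty$. In particular, let $\mu\in\mathcal M[[0,\infty);(s^{(1)}_j)_{j=0}^\infty]$ and let $\mu_t(B)=\int_B t\,\mu(dt)$ for Borel $B\subseteq[0,\infty)$. Then $\mu_t$ belongs to $\mathcal M[[0,\infty);(s^{(1)}_{j+1})_{j=0}^\infty]$, $$\int_{[0,\infty)}[s_0^{-1}Q^\sharp_m(t)]^*\,\mu(dt)\,[s_0^{-1}Q^\sharp_n(t)]=\begin{cases}0,&m\ne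 n,\\ \hat L_n,&m=n,\end{cases}\qquad\text{for all }m,n\ge0,$$ $$\int_{[0,\infty)}[s_0^{-1}Q_m(t)]^*\,\mu_t(dt)\,[s_0^{-1}Q_n(t)]=\begin{cases}0,&m\ne n,\\ L_n,&m=n,\end{cases}\qquad\text{for all }m,n\ge0\text{ with }(m,n)\ne(0,0).$$ -/

import Mathlib

open MeasureTheory Matrix
open scoped NNReal ComplexOrder

noncomputable section

namespace StieltjesMoment

/-! ### Moore-Penrose inverse, reciprocal sequence, first transform -/

/-- `G` satisfies the four Penrose equations for `A`. -/
def IsMoorePenrose {p q : ℕ} (A : Matrix (Fin p) (Fin q) ℂ) (G : Matrix (Fin q) (Fin p) ℂ) : Prop :=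
  A * G * A = A ∧ G * A * G = G ∧ (A * G)ᴴ = A * G ∧ (G * A)ᴴ = G * A

/-- The Moore-Penrose inverse of a complex matrix. -/
def moorePenrose {p q : ℕ} (A : Matrix (Fin p) (Fin q) ℂ) : Matrix (Fin q) (Fin p) ℂ :=
  Classical.epsilon fun G => IsMoorePenrose A G

theorem moorePenrose_eq_inv {q : ℕ} (A : Matrix (Fin q) (Fin q) ℂ) (hA : IsUnit A.det) :
    moorePenrose A = A⁻¹ := by
  have h1 : A * A⁻¹ = 1 := A.mul_nonsing_inv hA
  have h2 : A⁻¹ * A = 1 := A.nonsing_inv_mul hA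
  have h : IsMoorePenrose A (moorePenrose A) :=
    Classical.epsilon_spec ⟨A⁻¹, by simp [IsMoorePenrose, h1, h2]⟩
  calc moorePenrose A = (A⁻¹ * A) * moorePenrose A * (A * A⁻¹) := by simp [h1, h2]
    _ = A⁻¹ * (A * moorePenrose A * A) * A⁻¹ := by simp only [Matrix.mul_assoc]
    _ = A⁻¹ := by rw [h.1, h2, Matrix.one_mul]

/-- The reciprocal sequence: `s♯₀ = s₀†` and `s♯ⱼ = - s₀† ∑_{l < j} s_{j-l} s♯ₗ` for `j ≥ 1`. -/
def reciprocal {q : ℕ} (s : ℕ → Matrix (Fin q) (Fin q) ℂ) : ℕ → Matrix (Fin q) (Fin q) ℂ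
  | 0 => moorePenrose (s 0)
  | j + 1 => -moorePenrose (s 0) * ∑ l : Fin (j + 1), s (j + 1 - l) * reciprocal s l
  termination_by j => j
  decreasing_by exact l.isLt

/-- The shifted sequence `(s_{j+1})_j`. -/
def shift {q : ℕ} (s : ℕ → Matrix (Fin q) (Fin q) ℂ) : ℕ → Matrix (Fin q) (Fin q) ℂ :=
  fun j => s (j + 1)

/-- The first transform `s⁽¹⁾ⱼ = - s₀ s♯_{j+1} s₀`. -/
def firstTransform {q : ℕ} (s : ℕ → Matrix (Fin q) (Fin q) ℂ) : ℕ → Matrix (Fin q) (Fin q) ℂ :=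
  fun j => -(s 0 * reciprocal s (j + 1) * s 0)

/-! ### Block Hankel matrices and Stieltjes positive definite sequences -/

/-- The block Hankel matrix `(s_{j+k})_{0 ≤ j, k < N}` with `N × N` blocks. Thus `H_n` is
`blockHankel s (n + 1)` and `K_n` is `blockHankel (shift s) (n + 1)`. -/
def blockHankel {q : ℕ} (s : ℕ → Matrix (Fin q) (Fin q) ℂ) (N : ℕ) :
    Matrix (Fin N × Fin q) (Fin N × Fin q) ℂ :=
  Matrix.of fun a b => s (a.1 + b.1) a.2 b.2

/-- The block column with the `N` blocks `s_l, s_{l+1}, …, s_{l+N-1}`. -/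
def blockCol {q : ℕ} (s : ℕ → Matrix (Fin q) (Fin q) ℂ) (l N : ℕ) :
    Matrix (Fin N × Fin q) (Fin q) ℂ :=
  Matrix.of fun a b => s (l + a.1) a.2 b

/-- The block row with the `N` blocks `s_l, s_{l+1}, …, s_{l+N-1}`. -/
def blockRow {q : ℕ} (s : ℕ → Matrix (Fin q) (Fin q) ℂ) (l N : ℕ) :
    Matrix (Fin q) (Fin N × Fin q) ℂ :=
  Matrix.of fun a b => s (l + b.1) a b.2

/-- The sequence is Stieltjes positive definite: `H_n` and `K_n` are positive definite for all
`n ≥ 0`. -/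
def IsStieltjesPosDef {q : ℕ} (s : ℕ → Matrix (Fin q) (Fin q) ℂ) : Prop :=
  ∀ n : ℕ, (blockHankel s (n + 1)).PosDef ∧ (blockHankel (shift s) (n + 1)).PosDef

/-- The Schur complement `L_n = s_{2n} - [s_n, …, s_{2n-1}] H_{n-1}⁻¹ [s_n; …; s_{2n-1}]` of
`H_{n-1}` in `H_n`; for `n = 0` the block matrices are empty and `L_0 = s_0`. (The inverse is a
true one when `H_{n-1}` is positive definite.) -/
def schurH {q : ℕ} (s : ℕ → Matrix (Fin q) (Fin q) ℂ) (n : ℕ) : Matrix (Fin q) (Fin q) ℂ :=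
  s (2 * n) - blockRow s n n * (blockHankel s n)⁻¹ * blockCol s n n

/-- The Schur complement of `K_{n-1}` in `K_n`,
`s_{2n+1} - [s_{n+1}, …, s_{2n}] K_{n-1}⁻¹ [s_{n+1}; …; s_{2n}]`, equal to `s_1` for `n = 0`. -/
def schurK {q : ℕ} (s : ℕ → Matrix (Fin q) (Fin q) ℂ) (n : ℕ) : Matrix (Fin q) (Fin q) ℂ :=
  s (2 * n + 1) -
    blockRow s (n + 1) n * (blockHankel (shift s) n)⁻¹ * blockCol s (n + 1) n

/-! ### The second kind matrix polynomials -/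

/-- `T_n = (δ_{j,k+1} I_q)_{0 ≤ j, k ≤ n}`. -/
def blockT (q n : ℕ) : Matrix (Fin (n + 1) × Fin q) (Fin (n + 1) × Fin q) ℂ :=
  Matrix.of fun a b => if (a.1 : ℕ) = (b.1 : ℕ) + 1 ∧ a.2 = b.2 then 1 else 0

/-- `R_n(z) = (I - z T_n)⁻¹`. -/
def blockR (q n : ℕ) (z : ℂ) : Matrix (Fin (n + 1) × Fin q) (Fin (n + 1) × Fin q) ℂ :=
  (1 - z • blockT q n)⁻¹

/-- The block column `u_n = [0; -s_0; …; -s_{n-1}]` with `n + 1` blocks (`u_0 = 0`). -/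
def blockU {q : ℕ} (s : ℕ → Matrix (Fin q) (Fin q) ℂ) (n : ℕ) :
    Matrix (Fin (n + 1) × Fin q) (Fin q) ℂ :=
  Matrix.of fun a b => Fin.cases (motive := fun _ => ℂ) 0 (fun i : Fin n => -s i a.2 b) a.1

/-- The block column `[X; I_q]`. -/
def appendOne {q n : ℕ} (X : Matrix (Fin n × Fin q) (Fin q) ℂ) :
    Matrix (Fin (n + 1) × Fin q) (Fin q) ℂ :=
  Matrix.of fun a b => Fin.lastCases (motive := fun _ => ℂ)
    ((1 : Matrix (Fin q) (Fin q) ℂ) a.2 b) (fun i : Fin n => X (i, a.2) b) a.1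

/-- `Q_n(z) = - u_n^* [R_n(z̄)]^* [-H_{n-1}⁻¹ [s_n; …; s_{2n-1}]; I_q]`; in particular `Q_0 = 0`. -/
def polyQ {q : ℕ} (s : ℕ → Matrix (Fin q) (Fin q) ℂ) (n : ℕ) (z : ℂ) :
    Matrix (Fin q) (Fin q) ℂ :=
  -((blockU s n)ᴴ * (blockR q n (star z))ᴴ *
    appendOne (-((blockHankel s n)⁻¹ * blockCol s n n)))

/-- `Q♯_n(z) = [s_0, …, s_n] [R_n(z̄)]^* [-K_{n-1}⁻¹ [s_{n+1}; …; s_{2n}]; I_q]`; in particular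
`Q♯_0 = s_0`. -/
def polyQSharp {q : ℕ} (s : ℕ → Matrix (Fin q) (Fin q) ℂ) (n : ℕ) (z : ℂ) :
    Matrix (Fin q) (Fin q) ℂ :=
  blockRow s 0 (n + 1) * (blockR q n (star z))ᴴ *
    appendOne (-((blockHankel (shift s) n)⁻¹ * blockCol s (n + 1) n))

/-! ### Monic right orthogonal systems -/

/-- The block column `[A_0; …; A_n]` of the first `n + 1` coefficients of a matrix polynomial. -/
def coeffCol {q : ℕ} (P : Polynomial (Matrix (Fin q) (Fin q) ℂ)) (n : ℕ) :
    Matrix (Fin (n + 1) × Fin q) (Fin q) ℂ :=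
  Matrix.of fun a b => P.coeff a.1 a.2 b

/-- The functions `F_k : ℂ → ℂ^{q×q}` are matrix polynomials that form a monic right orthogonal
system with respect to `s`: `F_k(z) = ∑ z^j A_{k,j}` has degree `k` and leading coefficient `I_q`,
and `Y_n(F_j)^* H_n Y_n(F_k) = 0` for `j ≠ k`, `n = max j k`. -/
def IsMonicRightOrthogonalSystem {q : ℕ} (s : ℕ → Matrix (Fin q) (Fin q) ℂ)
    (F : ℕ → ℂ → Matrix (Fin q) (Fin q) ℂ) : Prop :=
  ∃ P : ℕ → Polynomial (Matrix (Fin q) (Fin q) ℂ),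
    (∀ k z, F k z = (P k).eval (Matrix.scalar (Fin q) z)) ∧
    (∀ k, (P k).degree = k) ∧
    (∀ k, (P k).leadingCoeff = 1) ∧
    ∀ j k, j ≠ k →
      (coeffCol (P j) (max j k))ᴴ * blockHankel s (max j k + 1) * coeffCol (P k) (max j k) = 0

/-! ### Nonnegative Hermitian measures on `[0, ∞)` and the moment problem -/

/-- A countably additive matrix-valued set function on the Borel sets of `[0, ∞)` all of whose
values are nonnegative Hermitian. -/
def IsNonnegHermitian {q : ℕ} (μ : VectorMeasure ℝ≥0 (Matrix (Fin q) (Fin q) ℂ)) : Prop :=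
  ∀ B : Set ℝ≥0, MeasurableSet B → (μ B).PosSemidef

/-- The complex measure formed by the `(k, l)` entries. -/
def entry {q : ℕ} (μ : VectorMeasure ℝ≥0 (Matrix (Fin q) (Fin q) ℂ)) (k l : Fin q) :
    VectorMeasure ℝ≥0 ℂ :=
  μ.mapRange (Matrix.entryAddMonoidHom ℂ k l) (continuous_id.matrix_elem k l)

/-- `∫ t^j μ(dt)`, entry by entry. -/
def moment {q : ℕ} (μ : VectorMeasure ℝ≥0 (Matrix (Fin q) (Fin q) ℂ)) (j : ℕ) :
    Matrix (Fin q) (Fin q) ℂ :=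
  Matrix.of fun k l =>
    (entry μ k l).integral (fun t : ℝ≥0 => (t : ℝ) ^ j) (ContinuousLinearMap.lsmul ℝ ℝ)

/-- `μ` is a nonnegative Hermitian measure on `[0, ∞)` for which all power moments exist and are
given by `s`. -/
def IsMomentSolution {q : ℕ} (μ : VectorMeasure ℝ≥0 (Matrix (Fin q) (Fin q) ℂ))
    (s : ℕ → Matrix (Fin q) (Fin q) ℂ) : Prop :=
  IsNonnegHermitian μ ∧
    ∀ j, (∀ k l, (entry μ k l).Integrable fun t : ℝ≥0 => (t : ℝ) ^ j) ∧ moment μ j = s j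

/-- The matrix integral `∫ F(t)^* μ(dt) G(t)` exists and equals `A`: its `(a, b)` entry is
`∑_{k,l} ∫ conj(F_{ka}(t)) G_{lb}(t) μ_{kl}(dt)`. -/
def HasMatrixIntegral {q : ℕ} (F : ℝ≥0 → Matrix (Fin q) (Fin q) ℂ)
    (μ : VectorMeasure ℝ≥0 (Matrix (Fin q) (Fin q) ℂ)) (G : ℝ≥0 → Matrix (Fin q) (Fin q) ℂ)
    (A : Matrix (Fin q) (Fin q) ℂ) : Prop :=
  (∀ a b k l, (entry μ k l).Integrable fun t => star (F t k a) * G t l b) ∧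
    ∀ a b, ∑ k, ∑ l, (entry μ k l).integral (fun t => star (F t k a) * G t l b)
      (ContinuousLinearMap.mul ℝ ℂ) = A a b

/-- The measure `B ↦ ∫_B t μ(dt)` (used for `μ` with an existing first moment). -/
def tWeighted {q : ℕ} (μ : VectorMeasure ℝ≥0 (Matrix (Fin q) (Fin q) ℂ)) :
    VectorMeasure ℝ≥0 (Matrix (Fin q) (Fin q) ℂ) where
  measureOf' B := Matrix.of fun k l =>
    (entry μ k l).withDensity (fun t : ℝ≥0 => (t : ℝ)) (ContinuousLinearMap.lsmul ℝ ℝ) B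
  empty' := by ext k l; simp
  not_measurable' B hB := by ext k l; simp [VectorMeasure.not_measurable _ hB]
  m_iUnion' f hf hd := by
    refine Pi.hasSum.2 fun k => Pi.hasSum.2 fun l => ?_
    exact VectorMeasure.m_iUnion _ hf hd

theorem tWeighted_apply {q : ℕ} (μ : VectorMeasure ℝ≥0 (Matrix (Fin q) (Fin q) ℂ))
    (hμ : ∀ k l, (entry μ k l).Integrable fun t : ℝ≥0 => (t : ℝ)) (B : Set ℝ≥0) (k l : Fin q) :
    tWeighted μ B k l = ((entry μ k l).restrict B).integral (fun t : ℝ≥0 => (t : ℝ))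
      (ContinuousLinearMap.lsmul ℝ ℝ) :=
  VectorMeasure.withDensity_apply (hμ k l)

end StieltjesMoment

end

/-! Write `S(x) = ∑ s_j x^j` and `T(x) = ∑ t_j x^j`, where `t` is the first transform. The
reciprocal sequence has generating series `S(x)⁻¹`, so `x T(x) = s₀ - s₀ S(x)⁻¹ s₀`. Since `∑
t_{a+b} x^a y^b = (x T(x) - y T(y)) / (x - y)`, it follows that `S(x) s₀⁻¹ (∑ t_{a+b} x^a y^b) s₀⁻¹
S(y) = (S(x) - S(y)) / (x - y) = ∑ s_{j+k+1} x^j y^k`. In matrix form, the upper triangular Toeplitz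
matrix `V` with blocks `s₀⁻¹ s_{k-i}` is a congruence from the Hankel matrix of `t` to that of the
shifted `s` (`toeplitz_congruence_firstTransform`). The same `V` carries the Hankel matrix of the
shifted `t` to the Schur complement of `s₀` in a Hankel matrix of `s`
(`toeplitz_congruence_shift_firstTransform`). Positive definiteness passes through both congruences.

The congruences also preserve Gram matrices. The coefficient column of `s₀⁻¹ Q♯_n` is `V` applied to
that of the monic orthogonal polynomial for the shifted `s`. The column of `s₀⁻¹ Q_n` is `V` applied
to that of the monic orthogonal polynomial for `s` with its constant coefficient deleted; for `n ≥
1`, orthogonality to constants recovers that coefficient, and this recovery is exactly the Schur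
complement elimination (`eliminator_mul_blockColumn`). Hence orthogonality and the values `schurK`,
`schurH` come from the classical ones in `hankelForm_monicCoeff`.

For a measure with moments `t`, a matrix integral of two polynomials is the Hankel form of their
coefficients (`hasMatrixIntegral_of_coeff`). It remains to see that weighting by `t` keeps the
values nonnegative Hermitian and shifts the moments (`IsMomentSolution.tWeighted`). -/

noncomputable section

namespace StieltjesMoment

variable {q : ℕ}

/-! ### Block matrices -/

/-- The block matrix with blocks `f i j`. -/
def blockMatrix {M N : ℕ} (f : Fin M → Fin N → Matrix (Fin q) (Fin q) ℂ) :
    Matrix (Fin M × Fin q) (Fin N × Fin q) ℂ :=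
  Matrix.of fun a b => f a.1 b.1 a.2 b.2

/-- The block column with the blocks `X 0, …, X (N - 1)`. -/
def blockColumn (N : ℕ) (X : ℕ → Matrix (Fin q) (Fin q) ℂ) :
    Matrix (Fin N × Fin q) (Fin q) ℂ :=
  Matrix.of fun a b => X a.1 a.2 b

theorem blockHankel_eq_blockMatrix (s : ℕ → Matrix (Fin q) (Fin q) ℂ) (N : ℕ) :
    blockHankel s N = blockMatrix fun i j : Fin N => s (i + j) := rfl

theorem blockMatrix_mul {M N K : ℕ} (f : Fin M → Fin N → Matrix (Fin q) (Fin q) ℂ)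
    (g : Fin N → Fin K → Matrix (Fin q) (Fin q) ℂ) :
    blockMatrix f * blockMatrix g = blockMatrix fun i k => ∑ j, f i j * g j k := by
  ext a b
  simp [blockMatrix, Matrix.mul_apply, Fintype.sum_prod_type, Matrix.sum_apply]

theorem conjTranspose_blockMatrix {M N : ℕ} (f : Fin M → Fin N → Matrix (Fin q) (Fin q) ℂ) :
    (blockMatrix f)ᴴ = blockMatrix fun i j => (f j i)ᴴ := rfl

theorem blockMatrix_mul_blockColumn {M N : ℕ} (f : ℕ → ℕ → Matrix (Fin q) (Fin q) ℂ)
    (X : ℕ → Matrix (Fin q) (Fin q) ℂ) :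
    blockMatrix (fun (i : Fin M) (j : Fin N) => f i j) * blockColumn N X =
      blockColumn M fun i => ∑ j ∈ Finset.range N, f i j * X j := by
  ext a b
  simp [blockMatrix, blockColumn, Matrix.mul_apply, Fintype.sum_prod_type, Matrix.sum_apply,
    ← Fin.sum_univ_eq_sum_range (fun j => ∑ x, f a.1 j a.2 x * X j x b)]

theorem conjTranspose_blockColumn_mul {N : ℕ} (X Y : ℕ → Matrix (Fin q) (Fin q) ℂ) :
    (blockColumn N X)ᴴ * blockColumn N Y = ∑ i ∈ Finset.range N, (X i)ᴴ * Y i := by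
  ext a b
  simp [blockColumn, Matrix.mul_apply, Fintype.sum_prod_type, Matrix.sum_apply,
    ← Fin.sum_univ_eq_sum_range (fun j => ∑ x, (starRingEnd ℂ) (X j x a) * Y j x b)]

theorem blockRow_mul_blockColumn {N l : ℕ} (s X : ℕ → Matrix (Fin q) (Fin q) ℂ) :
    blockRow s l N * blockColumn N X = ∑ i ∈ Finset.range N, s (l + i) * X i := by
  ext a b
  simp [blockColumn, blockRow, Matrix.mul_apply, Fintype.sum_prod_type, Matrix.sum_apply,
    ← Fin.sum_univ_eq_sum_range (fun j => ∑ x, s (l + j) a x * X j x b)]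

theorem blockColumn_congr {N : ℕ} {X Y : ℕ → Matrix (Fin q) (Fin q) ℂ}
    (h : ∀ i < N, X i = Y i) : blockColumn N X = blockColumn N Y := by
  ext a b
  simp [blockColumn, h a.1 a.1.isLt]

theorem sum_fin_ite_le {A : Type*} [AddCommMonoid A] {N j : ℕ} (hj : j < N) (f : ℕ → A) :
    ∑ a : Fin N, (if (a : ℕ) ≤ j then f a else 0) = ∑ a ∈ Finset.range (j + 1), f a := by
  rw [Fin.sum_univ_eq_sum_range (fun a => if a ≤ j then f a else 0), ← Finset.sum_filter]
  congr 1
  ext a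
  simp only [Finset.mem_filter, Finset.mem_range]
  omega

/-! ### Stieltjes positive definite sequences -/

theorem IsStieltjesPosDef.shift_posDef {s : ℕ → Matrix (Fin q) (Fin q) ℂ}
    (hs : IsStieltjesPosDef s) (N : ℕ) : (blockHankel (shift s) N).PosDef := by
  have h : (blockHankel (shift s) N) = (blockHankel (shift s) (N + 1)).submatrix
      (fun a => (a.1.castSucc, a.2)) (fun a => (a.1.castSucc, a.2)) := rfl
  rw [h]
  exact (hs N).2.submatrix fun a b hab => by simpa [Prod.ext_iff] using hab

theorem IsStieltjesPosDef.posDef {s : ℕ → Matrix (Fin q) (Fin q) ℂ}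
    (hs : IsStieltjesPosDef s) (N : ℕ) : (blockHankel s N).PosDef := by
  have h : (blockHankel s N) = (blockHankel s (N + 1)).submatrix
      (fun a => (a.1.castSucc, a.2)) (fun a => (a.1.castSucc, a.2)) := rfl
  rw [h]
  exact (hs N).1.submatrix fun a b hab => by simpa [Prod.ext_iff] using hab

theorem IsStieltjesPosDef.conjTranspose_eq {s : ℕ → Matrix (Fin q) (Fin q) ℂ}
    (hs : IsStieltjesPosDef s) (j : ℕ) : (s j)ᴴ = s j := by
  ext a b
  have h := congrFun₂ (hs j).1.isHermitian ((0 : Fin (j + 1)), a) (Fin.last j, b)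
  simpa [blockHankel] using h

theorem IsStieltjesPosDef.isUnit_det {s : ℕ → Matrix (Fin q) (Fin q) ℂ}
    (hs : IsStieltjesPosDef s) : IsUnit (s 0).det := by
  have h : (s 0) = (blockHankel s 1).submatrix (fun a => (0, a)) (fun a => (0, a)) := rfl
  have h2 : (s 0).PosDef := by
    rw [h]
    exact (hs 0).1.submatrix fun a b hab => by simpa using hab
  exact (Matrix.isUnit_iff_isUnit_det _).1 h2.isUnit

/-! ### Convolution identities for the first transform -/

theorem reciprocal_zero (s : ℕ → Matrix (Fin q) (Fin q) ℂ) (h0 : IsUnit (s 0).det) :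
    reciprocal s 0 = (s 0)⁻¹ := by
  rw [reciprocal, moorePenrose_eq_inv _ h0]

theorem sum_mul_reciprocal (s : ℕ → Matrix (Fin q) (Fin q) ℂ) (h0 : IsUnit (s 0).det) (j : ℕ) :
    ∑ l ∈ Finset.range (j + 2), s (j + 1 - l) * reciprocal s l = 0 := by
  rw [Finset.sum_range_succ, reciprocal, moorePenrose_eq_inv _ h0,
    Fin.sum_univ_eq_sum_range (fun l => s (j + 1 - l) * reciprocal s l) (j + 1)]
  simp [← Matrix.mul_assoc, Matrix.mul_nonsing_inv _ h0]

/-- `∑_{a ≤ j} s_{j-a} s₀⁻¹ t_a = s_{j+1}` for the first transform `t` of `s`. -/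
theorem sum_mul_firstTransform (s : ℕ → Matrix (Fin q) (Fin q) ℂ) (h0 : IsUnit (s 0).det)
    (j : ℕ) :
    ∑ a ∈ Finset.range (j + 1), s (j - a) * (s 0)⁻¹ * firstTransform s a = s (j + 1) := by
  have h := sum_mul_reciprocal s h0 j
  rw [Finset.sum_range_succ', reciprocal_zero s h0] at h
  -- Isolate the term `l = 0`, namely `s_{j+1} s₀⁻¹`, and cancel its inverse by multiplying with
  -- `s₀` from the right.
  have h2 := congrArg (· * s 0) (eq_neg_of_add_eq_zero_right h)
  simp only [Nat.sub_zero, Matrix.mul_assoc, Matrix.nonsing_inv_mul _ h0, Matrix.mul_one] at h2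
  rw [h2, Matrix.neg_mul, Finset.sum_mul, ← Finset.sum_neg_distrib]
  refine Finset.sum_congr rfl fun a _ => ?_
  simp only [firstTransform, Nat.add_sub_add_right, Matrix.mul_neg, Matrix.mul_assoc]
  rw [Matrix.nonsing_inv_mul_cancel_left _ _ h0]

/-- As a power series over the matrix ring, the reciprocal is a right inverse of the series of `s`.
Taking adjoints coefficientwise makes its adjoint a left inverse, because every `s_j` is Hermitian;
the two inverses must coincide. -/
theorem conjTranspose_reciprocal {s : ℕ → Matrix (Fin q) (Fin q) ℂ} (hs : IsStieltjesPosDef s)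
    (j : ℕ) : (reciprocal s j)ᴴ = reciprocal s j := by
  have h0 := hs.isUnit_det
  have h : ∀ n, ∑ p ∈ Finset.HasAntidiagonal.antidiagonal n, s p.1 * reciprocal s p.2 =
      if n = 0 then 1 else 0 := by
    rintro (_ | n)
    · simp [reciprocal_zero s h0, Matrix.mul_nonsing_inv _ h0]
    · rw [← Finset.Nat.sum_antidiagonal_swap]
      simpa [Finset.Nat.sum_antidiagonal_eq_sum_range_succ fun i j => s j * reciprocal s i]
        using sum_mul_reciprocal s h0 n
  have hr : PowerSeries.mk s * PowerSeries.mk (reciprocal s) = 1 := by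
    ext1 n
    simp [PowerSeries.coeff_mul, h, PowerSeries.coeff_one]
  have hl : PowerSeries.mk (fun j => (reciprocal s j)ᴴ) * PowerSeries.mk s = 1 := by
    ext1 n
    have := congrArg Matrix.conjTranspose (h n)
    rw [Matrix.conjTranspose_sum, ← Finset.Nat.sum_antidiagonal_swap] at this
    simpa [PowerSeries.coeff_mul, PowerSeries.coeff_one, hs.conjTranspose_eq, apply_ite] using this
  simpa using congrArg (PowerSeries.coeff j) (left_inv_eq_right_inv hl hr)

theorem conjTranspose_firstTransform {s : ℕ → Matrix (Fin q) (Fin q) ℂ}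
    (hs : IsStieltjesPosDef s) (j : ℕ) : (firstTransform s j)ᴴ = firstTransform s j := by
  simp [firstTransform, conjTranspose_reciprocal hs, hs.conjTranspose_eq, Matrix.mul_assoc]

/-- `∑_{b ≤ k} t_b s₀⁻¹ s_{k-b} = s_{k+1}` for the first transform `t` of `s`. -/
theorem sum_firstTransform_mul {s : ℕ → Matrix (Fin q) (Fin q) ℂ} (hs : IsStieltjesPosDef s)
    (k : ℕ) :
    ∑ b ∈ Finset.range (k + 1), firstTransform s b * ((s 0)⁻¹ * s (k - b)) = s (k + 1) := by
  have h := congrArg Matrix.conjTranspose (sum_mul_firstTransform s hs.isUnit_det k)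
  simpa [Matrix.conjTranspose_sum, conjTranspose_firstTransform hs, hs.conjTranspose_eq,
    Matrix.conjTranspose_nonsing_inv] using h

theorem sum_mul_firstTransform_add_succ (s : ℕ → Matrix (Fin q) (Fin q) ℂ) (j m : ℕ) :
    ∑ a ∈ Finset.range (j + 1), s (j - a) * (s 0)⁻¹ * firstTransform s (a + (m + 1)) =
      ∑ a ∈ Finset.range (j + 2), s (j + 1 - a) * (s 0)⁻¹ * firstTransform s (a + m) -
        s (j + 1) * (s 0)⁻¹ * firstTransform s m := by
  rw [Finset.sum_range_succ' _ (j + 1)]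
  simp [add_assoc, add_comm 1 m]

/-- Raising the index of the transform is traded for raising `j`. The price is the boundary term `a
= 0`, whose sum over `b` collapses by `sum_firstTransform_mul`. -/
theorem sum_mul_firstTransform_succ_mul {s : ℕ → Matrix (Fin q) (Fin q) ℂ}
    (hs : IsStieltjesPosDef s) (j k : ℕ) :
    ∑ b ∈ Finset.range (k + 1), (∑ a ∈ Finset.range (j + 1),
        s (j - a) * (s 0)⁻¹ * firstTransform s (a + (b + 1))) * ((s 0)⁻¹ * s (k - b)) =
      ∑ b ∈ Finset.range (k + 1), (∑ a ∈ Finset.range (j + 2),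
        s (j + 1 - a) * (s 0)⁻¹ * firstTransform s (a + b)) * ((s 0)⁻¹ * s (k - b)) -
      s (j + 1) * (s 0)⁻¹ * s (k + 1) := by
  simp_rw [sum_mul_firstTransform_add_succ, Matrix.sub_mul]
  rw [Finset.sum_sub_distrib]
  simp_rw [Matrix.mul_assoc (s (j + 1) * (s 0)⁻¹)]
  rw [← Finset.mul_sum, sum_firstTransform_mul hs]

/-- Coefficient form of the generating function identity. In the induction on `k` the summand `b =
0` equals `s_{j+1} s₀⁻¹ s_{k+1}` and cancels the boundary term of the index exchange; the exchange
raises `j`, so `j` must stay general. -/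
theorem sum_sum_firstTransform {s : ℕ → Matrix (Fin q) (Fin q) ℂ} (hs : IsStieltjesPosDef s)
    (j k : ℕ) :
    ∑ b ∈ Finset.range (k + 1), (∑ a ∈ Finset.range (j + 1),
        s (j - a) * (s 0)⁻¹ * firstTransform s (a + b)) * ((s 0)⁻¹ * s (k - b)) =
      s (j + k + 1) := by
  induction k generalizing j with
  | zero =>
    simpa [Matrix.nonsing_inv_mul _ hs.isUnit_det] using sum_mul_firstTransform s hs.isUnit_det j
  | succ k ih =>
    rw [Finset.sum_range_succ']
    simp only [Nat.add_sub_add_right]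
    rw [sum_mul_firstTransform_succ_mul hs, ih (j + 1)]
    simp only [add_zero, sum_mul_firstTransform s hs.isUnit_det, Nat.sub_zero, ← Matrix.mul_assoc]
    rw [sub_add_cancel]
    congr 1
    omega

/-- Here nothing cancels the boundary term of the index exchange, and it becomes the correction term
of the Schur complement of `s₀`. -/
theorem sum_sum_shift_firstTransform {s : ℕ → Matrix (Fin q) (Fin q) ℂ}
    (hs : IsStieltjesPosDef s) (j k : ℕ) :
    ∑ b ∈ Finset.range (k + 1), (∑ a ∈ Finset.range (j + 1),
        s (j - a) * (s 0)⁻¹ * shift (firstTransform s) (a + b)) * ((s 0)⁻¹ * s (k - b)) =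
      s (j + k + 2) - s (j + 1) * (s 0)⁻¹ * s (k + 1) := by
  have h := sum_mul_firstTransform_succ_mul hs j k
  rw [sum_sum_firstTransform hs (j + 1) k] at h
  simpa only [shift, add_assoc, add_comm, add_left_comm] using h

/-! ### Congruences of block Hankel matrices -/

/-- The upper triangular block Toeplitz matrix with the blocks `s₀⁻¹ s_{k-i}`, `i ≤ k`. -/
def toeplitz (s : ℕ → Matrix (Fin q) (Fin q) ℂ) (N : ℕ) :
    Matrix (Fin N × Fin q) (Fin N × Fin q) ℂ :=
  blockMatrix fun i k : Fin N => if (i : ℕ) ≤ k then (s 0)⁻¹ * s (k - i) else 0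

theorem toeplitz_congruence {s : ℕ → Matrix (Fin q) (Fin q) ℂ} (hs : IsStieltjesPosDef s)
    (t : ℕ → Matrix (Fin q) (Fin q) ℂ) (N : ℕ) :
    (toeplitz s N)ᴴ * blockHankel t N * toeplitz s N = blockMatrix fun j k : Fin N =>
      ∑ b ∈ Finset.range ((k : ℕ) + 1), (∑ a ∈ Finset.range ((j : ℕ) + 1),
        s (j - a) * (s 0)⁻¹ * t (a + b)) * ((s 0)⁻¹ * s (k - b)) := by
  rw [toeplitz, conjTranspose_blockMatrix, blockHankel_eq_blockMatrix, blockMatrix_mul,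
    blockMatrix_mul]
  congr 1
  ext1 j
  ext1 k
  have h1 : ∀ b : Fin N, ∑ a : Fin N,
      (if (a : ℕ) ≤ j then (s 0)⁻¹ * s (j - a) else 0)ᴴ * t (a + b) =
      ∑ a ∈ Finset.range ((j : ℕ) + 1), s (j - a) * (s 0)⁻¹ * t (a + b) := fun b => by
    rw [← sum_fin_ite_le j.isLt]
    refine Finset.sum_congr rfl fun a _ => ?_
    split_ifs <;> simp [hs.conjTranspose_eq, Matrix.conjTranspose_nonsing_inv]
  simp_rw [h1, mul_ite, mul_zero]
  exact sum_fin_ite_le k.isLt fun b => (∑ a ∈ Finset.range ((j : ℕ) + 1),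
    s (j - a) * (s 0)⁻¹ * t (a + b)) * ((s 0)⁻¹ * s (k - b))

theorem toeplitz_congruence_firstTransform {s : ℕ → Matrix (Fin q) (Fin q) ℂ}
    (hs : IsStieltjesPosDef s) (N : ℕ) :
    (toeplitz s N)ᴴ * blockHankel (firstTransform s) N * toeplitz s N =
      blockHankel (shift s) N := by
  rw [toeplitz_congruence hs]
  simp_rw [sum_sum_firstTransform hs]
  rfl

/-- The block matrix `[-s₀⁻¹ [s_1, …, s_N]; I]`, which realizes the Schur complement of `s₀` in
a block Hankel matrix. -/
def eliminator (s : ℕ → Matrix (Fin q) (Fin q) ℂ) (N : ℕ) :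
    Matrix (Fin (N + 1) × Fin q) (Fin N × Fin q) ℂ :=
  blockMatrix fun i k => Fin.cases (-((s 0)⁻¹ * s (k + 1)))
    (fun i : Fin N => if i = k then 1 else 0) i

theorem eliminator_congruence {s : ℕ → Matrix (Fin q) (Fin q) ℂ} (hs : IsStieltjesPosDef s)
    (N : ℕ) :
    (eliminator s N)ᴴ * blockHankel s (N + 1) * eliminator s N =
      blockMatrix fun j k : Fin N => s (j + k + 2) - s (j + 1) * (s 0)⁻¹ * s (k + 1) := by
  rw [eliminator, conjTranspose_blockMatrix, blockHankel_eq_blockMatrix, blockMatrix_mul,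
    blockMatrix_mul]
  congr 1
  ext1 j
  ext1 k
  have h : ∀ i : Fin (N + 1), ∑ x : Fin (N + 1), (Fin.cases (-((s 0)⁻¹ * s (j + 1)))
      (fun i : Fin N => if i = j then 1 else 0) x : Matrix (Fin q) (Fin q) ℂ)ᴴ * s (x + i) =
      s (j + 1 + i) - s (j + 1) * (s 0)⁻¹ * s i := fun i => by
    rw [Fin.sum_univ_succ, Fintype.sum_eq_single j (fun x hx => by simp [hx])]
    simp [hs.conjTranspose_eq, Matrix.conjTranspose_nonsing_inv]
    abel
  simp_rw [h]
  rw [Fin.sum_univ_succ, Fintype.sum_eq_single k (fun x hx => by simp [hx])]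
  simp [Matrix.mul_assoc, Matrix.nonsing_inv_mul _ hs.isUnit_det]
  congr 1
  omega

theorem toeplitz_congruence_shift_firstTransform {s : ℕ → Matrix (Fin q) (Fin q) ℂ}
    (hs : IsStieltjesPosDef s) (N : ℕ) :
    (toeplitz s N)ᴴ * blockHankel (shift (firstTransform s)) N * toeplitz s N =
      (eliminator s N)ᴴ * blockHankel s (N + 1) * eliminator s N := by
  rw [toeplitz_congruence hs, eliminator_congruence hs]
  simp_rw [sum_sum_shift_firstTransform hs]

/-- The Toeplitz matrix is a factor of an invertible matrix, the Hankel matrix of the shifted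
sequence, so its determinant is a unit. -/
theorem isUnit_toeplitz {s : ℕ → Matrix (Fin q) (Fin q) ℂ} (hs : IsStieltjesPosDef s) (N : ℕ) :
    IsUnit (toeplitz s N) := by
  have h := (hs.shift_posDef N).isUnit
  rw [← toeplitz_congruence_firstTransform hs, Matrix.isUnit_iff_isUnit_det, Matrix.det_mul] at h
  exact (Matrix.isUnit_iff_isUnit_det _).2 (isUnit_of_mul_isUnit_right h)

theorem posDef_of_congruence {n : Type*} [Fintype n] [DecidableEq n] {A U : Matrix n n ℂ}
    (hU : IsUnit U) (h : (Uᴴ * A * U).PosDef) : A.PosDef := by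
  have hd := (Matrix.isUnit_iff_isUnit_det _).1 hU
  have h2 := h.conjTranspose_mul_mul_same (B := U⁻¹)
    (Matrix.mulVec_injective_iff_isUnit.2 (Matrix.isUnit_nonsing_inv_iff.2 hU))
  have h3 : U⁻¹ᴴ * Uᴴ = 1 := by
    rw [← Matrix.conjTranspose_mul, Matrix.mul_nonsing_inv _ hd, Matrix.conjTranspose_one]
  rwa [← Matrix.mul_assoc, ← Matrix.mul_assoc, h3, Matrix.one_mul, Matrix.mul_assoc,
    Matrix.mul_nonsing_inv _ hd, Matrix.mul_one] at h2

theorem eliminator_mulVec_injective (s : ℕ → Matrix (Fin q) (Fin q) ℂ) (N : ℕ) :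
    Function.Injective (eliminator s N).mulVec := by
  -- Below the first block row the eliminator is the identity, so a vector can be read off from its
  -- image.
  have hx : ∀ x i a, (eliminator s N).mulVec x (i.succ, a) = x (i, a) := fun x i a => by
    simp only [eliminator, blockMatrix, Matrix.mulVec, dotProduct, Matrix.of_apply,
      Fintype.sum_prod_type, Fin.cases_succ]
    rw [Fintype.sum_eq_single i (fun k hk => by simp [hk.symm])]
    simp [Matrix.one_apply]
  intro x y h
  ext ⟨i, a⟩
  rw [← hx x, h, hx]

theorem posDef_firstTransform {s : ℕ → Matrix (Fin q) (Fin q) ℂ} (hs : IsStieltjesPosDef s)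
    (N : ℕ) : (blockHankel (firstTransform s) N).PosDef :=
  posDef_of_congruence (isUnit_toeplitz hs N) <| by
    rw [toeplitz_congruence_firstTransform hs]
    exact hs.shift_posDef N

theorem posDef_shift_firstTransform {s : ℕ → Matrix (Fin q) (Fin q) ℂ}
    (hs : IsStieltjesPosDef s) (N : ℕ) : (blockHankel (shift (firstTransform s)) N).PosDef :=
  posDef_of_congruence (isUnit_toeplitz hs N) <| by
    rw [toeplitz_congruence_shift_firstTransform hs]
    exact (hs.posDef _).conjTranspose_mul_mul_same (eliminator_mulVec_injective s N)

theorem IsStieltjesPosDef.firstTransform {s : ℕ → Matrix (Fin q) (Fin q) ℂ}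
    (hs : IsStieltjesPosDef s) : IsStieltjesPosDef (firstTransform s) := fun _ =>
  ⟨posDef_firstTransform hs _, posDef_shift_firstTransform hs _⟩

/-- Shifting twice deletes the first block row and column of a larger Hankel matrix, leaving a
principal submatrix. -/
theorem IsStieltjesPosDef.shift {s : ℕ → Matrix (Fin q) (Fin q) ℂ}
    (hs : IsStieltjesPosDef s) : IsStieltjesPosDef (shift s) := fun n => by
  refine ⟨(hs n).2, ?_⟩
  have h : blockHankel (StieltjesMoment.shift (StieltjesMoment.shift s)) (n + 1) =
      (blockHankel s (n + 2)).submatrix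
        (fun a => (a.1.succ, a.2)) (fun a => (a.1.succ, a.2)) := by
    ext a b
    simp only [blockHankel, StieltjesMoment.shift, Matrix.of_apply, Matrix.submatrix_apply,
      Fin.val_succ]
    rw [show (a.1 + b.1 + 1 + 1 : ℕ) = a.1 + 1 + (b.1 + 1) by omega]
  rw [h]
  exact (hs (n + 1)).1.submatrix fun a b hab => by simpa [Prod.ext_iff] using hab

/-! ### Monic orthogonal matrix polynomials -/

/-- The coefficients of the monic orthogonal matrix polynomial of degree `n` with respect to `r`,
extended by zero. -/
def monicCoeff (r : ℕ → Matrix (Fin q) (Fin q) ℂ) (n i : ℕ) : Matrix (Fin q) (Fin q) ℂ :=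
  if h : i < n then
    Matrix.of fun a b => -((blockHankel r n)⁻¹ * blockCol r n n) (⟨i, h⟩, a) b
  else if i = n then 1 else 0

@[simp]
theorem monicCoeff_self (r : ℕ → Matrix (Fin q) (Fin q) ℂ) (n : ℕ) : monicCoeff r n n = 1 := by
  simp [monicCoeff]

theorem monicCoeff_of_lt (r : ℕ → Matrix (Fin q) (Fin q) ℂ) {n i : ℕ} (h : n < i) :
    monicCoeff r n i = 0 := by
  simp [monicCoeff, h.not_gt, h.ne']

theorem blockColumn_monicCoeff (r : ℕ → Matrix (Fin q) (Fin q) ℂ) (n : ℕ) :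
    blockColumn n (monicCoeff r n) = -((blockHankel r n)⁻¹ * blockCol r n n) := by
  ext a b
  simp [blockColumn, monicCoeff]

theorem appendOne_eq_blockColumn (r : ℕ → Matrix (Fin q) (Fin q) ℂ) (n : ℕ) :
    appendOne (-((blockHankel r n)⁻¹ * blockCol r n n)) =
      blockColumn (n + 1) (monicCoeff r n) := by
  ext ⟨i, a⟩ b
  refine Fin.lastCases ?_ (fun i => ?_) i
  · simp [appendOne, blockColumn]
  · simp [appendOne, blockColumn, monicCoeff]

/-- These are the normal equations that define the lower coefficients: the polynomial is orthogonal
to all powers below its degree. -/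
theorem sum_mul_monicCoeff_of_lt {r : ℕ → Matrix (Fin q) (Fin q) ℂ} {n i : ℕ}
    (hr : (blockHankel r n).PosDef) (hi : i < n) :
    ∑ k ∈ Finset.range (n + 1), r (i + k) * monicCoeff r n k = 0 := by
  have h := blockMatrix_mul_blockColumn (M := n) (N := n) (fun i j => r (i + j)) (monicCoeff r n)
  rw [← blockHankel_eq_blockMatrix, blockColumn_monicCoeff, Matrix.mul_neg,
    Matrix.mul_nonsing_inv_cancel_left _ _ ((Matrix.isUnit_iff_isUnit_det _).1 hr.isUnit)] at h
  rw [Finset.sum_range_succ, monicCoeff_self, Matrix.mul_one]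
  ext a b
  have h2 := congrFun₂ h (⟨i, hi⟩, a) b
  simp only [blockCol, blockColumn, Matrix.neg_apply, Matrix.of_apply] at h2
  simp [← h2, add_comm]

theorem sum_mul_monicCoeff_self (r : ℕ → Matrix (Fin q) (Fin q) ℂ) (n : ℕ) :
    ∑ k ∈ Finset.range (n + 1), r (n + k) * monicCoeff r n k = schurH r n := by
  rw [Finset.sum_range_succ, monicCoeff_self, Matrix.mul_one, ← blockRow_mul_blockColumn,
    blockColumn_monicCoeff, schurH, Matrix.mul_neg, Matrix.mul_assoc, two_mul]
  abel

theorem schurK_eq_schurH_shift (s : ℕ → Matrix (Fin q) (Fin q) ℂ) (n : ℕ) :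
    schurK s n = schurH (shift s) n := by
  have h1 : blockRow s (n + 1) n = blockRow (shift s) n n := by
    ext a b
    simp only [blockRow, shift, Matrix.of_apply]
    rw [add_right_comm]
  have h2 : blockCol s (n + 1) n = blockCol (shift s) n n := by
    ext a b
    simp only [blockCol, shift, Matrix.of_apply]
    rw [add_right_comm]
  rw [schurK, schurH, h1, h2, shift]

/-- The sesquilinear form `∑_{i, j < N} X_i^* r_{i+j} Y_j`. -/
def hankelForm (r : ℕ → Matrix (Fin q) (Fin q) ℂ) (N : ℕ)
    (X Y : ℕ → Matrix (Fin q) (Fin q) ℂ) : Matrix (Fin q) (Fin q) ℂ :=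
  (blockColumn N X)ᴴ * blockHankel r N * blockColumn N Y

theorem hankelForm_eq_sum (r : ℕ → Matrix (Fin q) (Fin q) ℂ) (N : ℕ)
    (X Y : ℕ → Matrix (Fin q) (Fin q) ℂ) :
    hankelForm r N X Y = ∑ i ∈ Finset.range N, (X i)ᴴ * ∑ k ∈ Finset.range N, r (i + k) * Y k := by
  rw [hankelForm, Matrix.mul_assoc, blockHankel_eq_blockMatrix,
    blockMatrix_mul_blockColumn fun i j => r (i + j), conjTranspose_blockColumn_mul]

/-- For `m ≤ n` the inner sum vanishes for `i < n` and the outer coefficient for `i > m`, so only `i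
= m` can contribute, with coefficient `1`. The opposite order follows by taking adjoints. Zero
padding makes the size `N` irrelevant. -/
theorem hankelForm_monicCoeff {r : ℕ → Matrix (Fin q) (Fin q) ℂ}
    (hr : ∀ N, (blockHankel r N).PosDef) {m n N : ℕ} (hm : m < N) (hn : n < N) :
    hankelForm r N (monicCoeff r m) (monicCoeff r n) = if m = n then schurH r n else 0 := by
  have key : ∀ m n : ℕ, m < N → n < N → m ≤ n →
      hankelForm r N (monicCoeff r m) (monicCoeff r n) = if m = n then schurH r n else 0 := by
    intro m n hm hn hmn
    have hz : ∀ i, ∑ k ∈ Finset.range N, r (i + k) * monicCoeff r n k =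
        ∑ k ∈ Finset.range (n + 1), r (i + k) * monicCoeff r n k := fun i => by
      refine (Finset.sum_subset (Finset.range_subset_range.2 hn) fun k _ hk => ?_).symm
      rw [monicCoeff_of_lt r (by simpa using hk), Matrix.mul_zero]
    rw [hankelForm_eq_sum]
    simp_rw [hz]
    rw [Finset.sum_eq_single m]
    · split_ifs with h
      · subst h
        simp [sum_mul_monicCoeff_self]
      · rw [sum_mul_monicCoeff_of_lt (hr n) (lt_of_le_of_ne hmn h), Matrix.mul_zero]
    · intro i _ hi
      rcases lt_or_gt_of_ne hi with h | h
      · rw [sum_mul_monicCoeff_of_lt (hr n) (h.trans_le hmn), Matrix.mul_zero]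
      · rw [monicCoeff_of_lt r h, Matrix.conjTranspose_zero, Matrix.zero_mul]
    · intro h
      exact absurd (Finset.mem_range.2 hm) h
  rcases le_or_gt m n with h | h
  · exact key m n hm hn h
  · have h2 := congrArg Matrix.conjTranspose (key n m hn hm h.le)
    rw [if_neg h.ne, hankelForm, Matrix.conjTranspose_mul, Matrix.conjTranspose_mul,
      Matrix.conjTranspose_conjTranspose, (hr N).isHermitian.eq, ← Matrix.mul_assoc] at h2
    rw [if_neg h.ne', hankelForm, h2, Matrix.conjTranspose_zero]

/-! ### Coefficients of the second kind polynomials -/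

/-- The coefficients of `s₀⁻¹ Q♯ₙ`. -/
def sharpCoeff (s : ℕ → Matrix (Fin q) (Fin q) ℂ) (n i : ℕ) : Matrix (Fin q) (Fin q) ℂ :=
  ∑ k ∈ Finset.range (n + 1), (if i ≤ k then (s 0)⁻¹ * s (k - i) else 0) *
    monicCoeff (shift s) n k

/-- The coefficients of `s₀⁻¹ Qₙ`. -/
def secondCoeff (s : ℕ → Matrix (Fin q) (Fin q) ℂ) (n i : ℕ) : Matrix (Fin q) (Fin q) ℂ :=
  ∑ k ∈ Finset.range n, (if i ≤ k then (s 0)⁻¹ * s (k - i) else 0) * monicCoeff s n (k + 1)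

theorem sharpCoeff_self {s : ℕ → Matrix (Fin q) (Fin q) ℂ} (h0 : IsUnit (s 0).det) (n : ℕ) :
    sharpCoeff s n n = 1 := by
  rw [sharpCoeff, Finset.sum_range_succ, Finset.sum_eq_zero fun k hk => by
    rw [if_neg (by simpa using hk), Matrix.zero_mul]]
  simp [Matrix.nonsing_inv_mul _ h0]

theorem sharpCoeff_of_lt (s : ℕ → Matrix (Fin q) (Fin q) ℂ) {n i : ℕ} (h : n < i) :
    sharpCoeff s n i = 0 :=
  Finset.sum_eq_zero fun k hk => by
    rw [if_neg (by have := Finset.mem_range.1 hk; omega), Matrix.zero_mul]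

theorem secondCoeff_succ_self {s : ℕ → Matrix (Fin q) (Fin q) ℂ} (h0 : IsUnit (s 0).det)
    (n : ℕ) : secondCoeff s (n + 1) n = 1 := by
  rw [secondCoeff, Finset.sum_range_succ, Finset.sum_eq_zero fun k hk => by
    rw [if_neg (by simpa using hk), Matrix.zero_mul]]
  simp [Matrix.nonsing_inv_mul _ h0]

theorem secondCoeff_of_le (s : ℕ → Matrix (Fin q) (Fin q) ℂ) {n i : ℕ} (h : n ≤ i) :
    secondCoeff s n i = 0 :=
  Finset.sum_eq_zero fun k hk => by
    rw [if_neg (by have := Finset.mem_range.1 hk; omega), Matrix.zero_mul]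

theorem blockColumn_sharpCoeff (s : ℕ → Matrix (Fin q) (Fin q) ℂ) {n N : ℕ} (hn : n < N) :
    blockColumn N (sharpCoeff s n) = toeplitz s N * blockColumn N (monicCoeff (shift s) n) := by
  rw [toeplitz, blockMatrix_mul_blockColumn fun i k => if i ≤ k then (s 0)⁻¹ * s (k - i) else 0]
  refine blockColumn_congr fun i _ =>
    Finset.sum_subset (Finset.range_subset_range.2 hn) fun k _ hk => ?_
  rw [monicCoeff_of_lt _ (by simpa using hk), Matrix.mul_zero]

theorem blockColumn_secondCoeff (s : ℕ → Matrix (Fin q) (Fin q) ℂ) {n N : ℕ} (hn : n ≤ N) :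
    blockColumn N (secondCoeff s n) =
      toeplitz s N * blockColumn N (fun k => monicCoeff s n (k + 1)) := by
  rw [toeplitz, blockMatrix_mul_blockColumn fun i k => if i ≤ k then (s 0)⁻¹ * s (k - i) else 0]
  refine blockColumn_congr fun i _ =>
    Finset.sum_subset (Finset.range_subset_range.2 hn) fun k _ hk => ?_
  rw [monicCoeff_of_lt _ (by simp at hk; omega), Matrix.mul_zero]

/-- Orthogonality to constants, `∑ s_k c_k = 0`, determines `c_0 = -s₀⁻¹ ∑ s_{k+1} c_{k+1}`, which
is the first block row of the eliminator. For `n = 0` this orthogonality is not available. -/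
theorem eliminator_mul_blockColumn {s : ℕ → Matrix (Fin q) (Fin q) ℂ}
    (hs : IsStieltjesPosDef s) {n N : ℕ} (h0 : n ≠ 0) (hn : n ≤ N) :
    eliminator s N * blockColumn N (fun k => monicCoeff s n (k + 1)) =
      blockColumn (N + 1) (monicCoeff s n) := by
  have h := sum_mul_monicCoeff_of_lt (hs.posDef n) (Nat.pos_of_ne_zero h0)
  rw [Finset.sum_subset (Finset.range_subset_range.2 (by omega : n + 1 ≤ N + 1)) fun k _ hk => by
    rw [monicCoeff_of_lt _ (by simpa using hk), Matrix.mul_zero], Finset.sum_range_succ'] at h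
  have h2 : monicCoeff s n 0 = ∑ k ∈ Finset.range N,
      -((s 0)⁻¹ * s (k + 1)) * monicCoeff s n (k + 1) := by
    have h3 := congrArg ((s 0)⁻¹ * ·) (eq_neg_of_add_eq_zero_right h)
    simp only [add_zero, zero_add, Matrix.nonsing_inv_mul_cancel_left _ _ hs.isUnit_det] at h3
    rw [h3, ← Finset.sum_neg_distrib, Finset.mul_sum]
    simp [Matrix.mul_assoc]
  have h4 : eliminator s N = blockMatrix fun (i : Fin (N + 1)) (k : Fin N) =>
      if (i : ℕ) = 0 then -((s 0)⁻¹ * s (k + 1)) else if (i : ℕ) = k + 1 then 1 else 0 := by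
    rw [eliminator]
    congr 1
    ext1 i
    ext1 k
    refine Fin.cases ?_ (fun i => ?_) i
    · simp
    · simp [Fin.ext_iff]
  rw [h4, blockMatrix_mul_blockColumn fun i k =>
    if i = 0 then -((s 0)⁻¹ * s (k + 1)) else if i = k + 1 then 1 else 0]
  refine blockColumn_congr fun i hi => ?_
  rcases i with _ | i
  · simp [h2]
  · have : i < N := by omega
    simp [this]

theorem hankelForm_sharpCoeff {s : ℕ → Matrix (Fin q) (Fin q) ℂ} (hs : IsStieltjesPosDef s)
    {m n N : ℕ} (hm : m < N) (hn : n < N) :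
    hankelForm (firstTransform s) N (sharpCoeff s m) (sharpCoeff s n) =
      if m = n then schurK s n else 0 := by
  rw [hankelForm, blockColumn_sharpCoeff s hm, blockColumn_sharpCoeff s hn,
    schurK_eq_schurH_shift, ← hankelForm_monicCoeff hs.shift_posDef hm hn, hankelForm,
    ← toeplitz_congruence_firstTransform hs]
  simp only [Matrix.conjTranspose_mul, Matrix.mul_assoc]

theorem hankelForm_secondCoeff {s : ℕ → Matrix (Fin q) (Fin q) ℂ} (hs : IsStieltjesPosDef s)
    {m n N : ℕ} (hm : m ≤ N) (hn : n ≤ N) (h : m ≠ 0 ∨ n ≠ 0) :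
    hankelForm (shift (firstTransform s)) N (secondCoeff s m) (secondCoeff s n) =
      if m = n then schurH s n else 0 := by
  -- Since `Q_0 = 0`, the form is zero as soon as one index is `0`. This agrees with the right-hand
  -- side only because `m = n = 0` is excluded.
  have hzero : secondCoeff s 0 = 0 := funext fun i => by simp [secondCoeff]
  by_cases hm0 : m = 0
  · rw [if_neg (by omega), hankelForm_eq_sum]
    simp [hm0, hzero]
  by_cases hn0 : n = 0
  · rw [if_neg (by omega), hankelForm_eq_sum]
    simp [hn0, hzero]
  rw [hankelForm, blockColumn_secondCoeff s hm, blockColumn_secondCoeff s hn,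
    ← hankelForm_monicCoeff hs.posDef (Nat.lt_succ_of_le hm) (Nat.lt_succ_of_le hn), hankelForm,
    ← eliminator_mul_blockColumn hs hm0 hm, ← eliminator_mul_blockColumn hs hn0 hn]
  have hc := congrArg (fun A => (blockColumn N (fun k => monicCoeff s m (k + 1)))ᴴ * A *
    blockColumn N (fun k => monicCoeff s n (k + 1))) (toeplitz_congruence_shift_firstTransform hs N)
  simpa only [Matrix.conjTranspose_mul, Matrix.mul_assoc] using hc

/-! ### Evaluation of the second kind polynomials -/

/-- The block shift is nilpotent, so the resolvent is the finite geometric series in `z T_n`. The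
proof verifies that the resulting triangular matrix of powers is a left inverse. -/
theorem conjTranspose_blockR (n : ℕ) (z : ℂ) :
    (blockR q n (star z))ᴴ = blockMatrix fun i k : Fin (n + 1) =>
      if (i : ℕ) ≤ k then z ^ (k - i : ℕ) • (1 : Matrix (Fin q) (Fin q) ℂ) else 0 := by
  have h1 : (1 : Matrix (Fin (n + 1) × Fin q) (Fin (n + 1) × Fin q) ℂ) =
      blockMatrix fun i k => if i = k then 1 else 0 := by
    ext ⟨i, a⟩ ⟨k, b⟩
    by_cases h1 : i = k <;> by_cases h3 : a = b <;>
      simp [blockMatrix, Matrix.one_apply, h1, h3]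
  have h2 : blockT q n = blockMatrix fun i k : Fin (n + 1) =>
      if (i : ℕ) = k + 1 then 1 else 0 := by
    ext ⟨i, a⟩ ⟨k, b⟩
    by_cases h1 : (i : ℕ) = k + 1 <;> by_cases h3 : a = b <;>
      simp [blockT, blockMatrix, h1, h3]
  have hT : (1 - star z • blockT q n)ᴴ = blockMatrix fun i k : Fin (n + 1) =>
      (if i = k then 1 else 0) -
        if (k : ℕ) = i + 1 then z • (1 : Matrix (Fin q) (Fin q) ℂ) else 0 := by
    rw [h1, h2]
    change blockMatrix (fun i k : Fin (n + 1) => ((if k = i then 1 else 0) -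
      star z • if (k : ℕ) = i + 1 then (1 : Matrix (Fin q) (Fin q) ℂ) else 0)ᴴ) = _
    congr 1
    ext1 i
    ext1 k
    rw [Matrix.conjTranspose_sub, Matrix.conjTranspose_smul, star_star, apply_ite conjTranspose,
      apply_ite conjTranspose, smul_ite]
    simp [eq_comm]
  rw [blockR, Matrix.conjTranspose_nonsing_inv, hT]
  refine Matrix.inv_eq_left_inv ?_
  rw [blockMatrix_mul, h1]
  congr 1
  ext1 i
  ext1 k
  simp_rw [mul_sub, Finset.sum_sub_distrib]
  rw [Finset.sum_eq_single k (fun j _ hj => by rw [if_neg hj, mul_zero])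
    (fun h => absurd (Finset.mem_univ _) h)]
  -- Column `0` has no predecessor under the shift; in column `k + 1` the subtracted sum reduces to
  -- the entry of column `k`, times `z`.
  refine Fin.cases ?_ (fun k => ?_) k
  · by_cases h : i = 0
    · simp [h]
    · simp [h]
  · rw [Finset.sum_eq_single k.castSucc (fun j _ hj => by
      rw [if_neg (c := (k.succ : ℕ) = j + 1)
        (fun h => hj (Fin.ext (by simpa using (Nat.succ.inj h).symm))), mul_zero]) (by simp)]
    simp only [Fin.val_succ, Fin.val_castSucc, if_true, mul_one]
    rcases lt_trichotomy (i : ℕ) (k + 1) with h | h | h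
    · rw [if_pos h.le, if_pos (Nat.lt_succ_iff.1 h), if_neg (fun h' => by simp [h'] at h),
        Nat.succ_sub (Nat.lt_succ_iff.1 h), pow_succ]
      simp [smul_smul, mul_comm]
    · rw [if_pos h.le, if_neg (by omega), if_pos (Fin.ext h)]
      simp [h]
    · rw [if_neg (by omega), if_neg (by omega), if_neg (fun h' => by simp [h'] at h)]
      simp

theorem sum_ite_le_reflect {A : Type*} [AddCommMonoid A] {k N : ℕ} (hk : k < N) (g : ℕ → ℕ → A) :
    ∑ i ∈ Finset.range N, (if i ≤ k then g i (k - i) else 0) =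
      ∑ i ∈ Finset.range N, (if i ≤ k then g (k - i) i else 0) := by
  have h : ∀ f : ℕ → A, ∑ i ∈ Finset.range N, (if i ≤ k then f i else 0) =
      ∑ i ∈ Finset.range (k + 1), f i := fun f => by
    rw [← sum_fin_ite_le hk, Fin.sum_univ_eq_sum_range (fun i => if i ≤ k then f i else 0)]
  rw [h, h, ← Finset.sum_flip]
  refine Finset.sum_congr rfl fun i hi => ?_
  rw [Nat.sub_sub_self (Finset.mem_range_succ_iff.1 hi)]

/-- The resolvent contributes `z^{k-i}`; reflecting `i ↦ k - i` for each fixed `k` collects equal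
powers of `z`. -/
theorem conjTranspose_mul_blockR_mul (c y : ℕ → Matrix (Fin q) (Fin q) ℂ) (n : ℕ) (z : ℂ) :
    (blockColumn (n + 1) c)ᴴ * (blockR q n (star z))ᴴ * blockColumn (n + 1) y =
      ∑ i ∈ Finset.range (n + 1), z ^ i • ∑ k ∈ Finset.range (n + 1),
        (if i ≤ k then (c (k - i))ᴴ else 0) * y k := by
  rw [conjTranspose_blockR, Matrix.mul_assoc, blockMatrix_mul_blockColumn fun i k =>
    if i ≤ k then z ^ (k - i : ℕ) • (1 : Matrix (Fin q) (Fin q) ℂ) else 0,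
    conjTranspose_blockColumn_mul]
  simp_rw [Finset.mul_sum, Finset.smul_sum]
  rw [Finset.sum_comm, Finset.sum_comm (s := Finset.range (n + 1)) (t := Finset.range (n + 1))
    (f := fun i k => z ^ i • ((if i ≤ k then (c (k - i))ᴴ else 0) * y k))]
  refine Finset.sum_congr rfl fun k hk => ?_
  have h := sum_ite_le_reflect (Finset.mem_range.1 hk) fun i j => z ^ j • ((c i)ᴴ * y k)
  simpa [ite_mul, mul_ite, smul_ite] using h

theorem polyQSharp_eq_sum {s : ℕ → Matrix (Fin q) (Fin q) ℂ} (hs : IsStieltjesPosDef s)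
    (n : ℕ) (z : ℂ) :
    (s 0)⁻¹ * polyQSharp s n z = ∑ i ∈ Finset.range (n + 1), z ^ i • sharpCoeff s n i := by
  have h1 : blockRow s 0 (n + 1) = (blockColumn (n + 1) s)ᴴ := by
    ext a b
    have := congrFun₂ (hs.conjTranspose_eq b.1) a b.2
    simpa [blockRow, blockColumn] using this.symm
  have h2 : blockCol s (n + 1) n = blockCol (shift s) n n := by
    ext a b
    simp only [blockCol, shift, Matrix.of_apply]
    rw [add_right_comm]
  rw [polyQSharp, h1, h2, appendOne_eq_blockColumn, conjTranspose_mul_blockR_mul]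
  simp_rw [Finset.mul_sum, sharpCoeff, Matrix.mul_smul, Finset.mul_sum, ← Matrix.mul_assoc,
    mul_ite, mul_zero, hs.conjTranspose_eq]

theorem polyQ_eq_sum {s : ℕ → Matrix (Fin q) (Fin q) ℂ} (hs : IsStieltjesPosDef s)
    (n : ℕ) (z : ℂ) :
    (s 0)⁻¹ * polyQ s n z = ∑ i ∈ Finset.range (n + 1), z ^ i • secondCoeff s n i := by
  have h1 : blockU s n = blockColumn (n + 1) (fun i => Nat.casesOn i 0 fun i => -s i) := by
    ext ⟨i, a⟩ b
    refine Fin.cases ?_ (fun i => ?_) i <;> simp [blockU, blockColumn]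
  rw [polyQ, h1, appendOne_eq_blockColumn, conjTranspose_mul_blockR_mul,
    ← Finset.sum_neg_distrib, Finset.mul_sum]
  refine Finset.sum_congr rfl fun i _ => ?_
  rw [← smul_neg, Matrix.mul_smul, secondCoeff, Finset.sum_range_succ']
  -- The zero block on top of `u_n` removes the constant coefficient of the orthogonal polynomial,
  -- so only the coefficients with index `k + 1` remain.
  have h0 : (if i ≤ 0 then (Nat.casesOn (0 - i) 0 fun i => -s i : Matrix (Fin q) (Fin q) ℂ)ᴴ
      else 0) * monicCoeff s n 0 = 0 := by
    simp
  rw [h0, add_zero, ← Finset.sum_neg_distrib, Finset.mul_sum]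
  refine congrArg _ (Finset.sum_congr rfl fun k _ => ?_)
  rcases lt_trichotomy i (k + 1) with h | h | h
  · rw [if_pos h.le, if_pos (Nat.lt_succ_iff.1 h), Nat.succ_sub (Nat.lt_succ_iff.1 h)]
    simp [hs.conjTranspose_eq, Matrix.mul_assoc]
  · simp [h]
  · rw [if_neg (by omega), if_neg (by omega)]
    simp

/-- A family of matrix polynomials with given coefficients is a monic right orthogonal system if
the coefficient columns are monic and orthogonal. -/
theorem isMonicRightOrthogonalSystem_of_coeff (hq : 0 < q) {t : ℕ → Matrix (Fin q) (Fin q) ℂ}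
    {F : ℕ → ℂ → Matrix (Fin q) (Fin q) ℂ} (p : ℕ → ℕ → Matrix (Fin q) (Fin q) ℂ)
    (hF : ∀ k z, F k z = ∑ i ∈ Finset.range (k + 1), z ^ i • p k i)
    (hp : ∀ k, p k k = 1) (hp0 : ∀ k i, k < i → p k i = 0)
    (ho : ∀ j k, j ≠ k → hankelForm t (max j k + 1) (p j) (p k) = 0) :
    IsMonicRightOrthogonalSystem t F := by
  -- For `q = 0` the matrix ring is trivial and no polynomial would have degree `k`.
  have : Nonempty (Fin q) := ⟨⟨0, hq⟩⟩
  let P : ℕ → Polynomial (Matrix (Fin q) (Fin q) ℂ) := fun k =>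
    ∑ i ∈ Finset.range (k + 1), Polynomial.monomial i (p k i)
  have hc : ∀ k, (P k).coeff = p k := fun k => by
    ext1 i
    simp only [P, Polynomial.finsetSum_coeff, Polynomial.coeff_monomial, Finset.sum_ite_eq',
      Finset.mem_range]
    split_ifs with h
    · rfl
    · exact (hp0 k i (by omega)).symm
  have hdeg : ∀ k, (P k).degree = k := fun k => by
    refine le_antisymm ((Polynomial.degree_le_iff_coeff_zero _ _).2 fun i hi => ?_)
      (Polynomial.le_degree_of_ne_zero ?_)
    · rw [hc]
      exact hp0 k i (by exact_mod_cast hi)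
    · rw [hc, hp]
      exact one_ne_zero
  refine ⟨P, fun k z => ?_, hdeg, fun k => ?_, fun j k hjk => ?_⟩
  · rw [hF, Polynomial.eval_finsetSum]
    refine Finset.sum_congr rfl fun i _ => ?_
    -- Evaluation writes the coefficient to the left of the power; a scalar matrix commutes past it.
    rw [Polynomial.eval_monomial, ← map_pow, ← Matrix.scalar_comm _ (fun _ => Commute.all _ _)]
    simp [Matrix.smul_eq_diagonal_mul]
  · rw [Polynomial.leadingCoeff, Polynomial.natDegree_eq_of_degree_eq_some (hdeg k), hc, hp]
  · have hcol : ∀ k N, coeffCol (P k) N = blockColumn (N + 1) (p k) := fun k N => by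
      rw [← hc]
      rfl
    rw [hcol, hcol]
    exact ho j k hjk

/-! ### Integrals with respect to vector measures with a density -/

section VectorMeasureDensity

variable {X F : Type*} {mX : MeasurableSpace X} [NormedAddCommGroup F] [NormedSpace ℝ F]
  {μ : VectorMeasure X F} {f g : X → ℝ}

open ContinuousLinearMap in
theorem variation_withDensity_lsmul [CompleteSpace F] (hg : μ.Integrable g) :
    (μ.withDensity g (lsmul ℝ ℝ)).variation = μ.variation.withDensity fun x => ‖g x‖ₑ := by
  rw [VectorMeasure.variation_withDensity hg (fun x y => by simp [nnnorm_smul]),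
    VectorMeasure.variation_transpose_lsmul]

open ContinuousLinearMap in
theorem integrable_withDensity_lsmul_iff [CompleteSpace F] (hg : μ.Integrable g)
    (hgm : Measurable g) (hg0 : ∀ x, 0 ≤ g x) :
    (μ.withDensity g (lsmul ℝ ℝ)).Integrable f ↔ μ.Integrable fun x => g x * f x := by
  rw [VectorMeasure.Integrable, variation_withDensity_lsmul hg,
    integrable_withDensity_iff_integrable_smul' hgm.enorm (by simp)]
  simp [abs_of_nonneg (hg0 _)]

open ContinuousLinearMap in
/-- Integration with respect to a vector measure with a real density. -/
theorem integral_withDensity_lsmul [CompleteSpace F] (hg : μ.Integrable g) (hgm : Measurable g)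
    (hg0 : ∀ x, 0 ≤ g x) (hf : (μ.withDensity g (lsmul ℝ ℝ)).Integrable f) :
    (μ.withDensity g (lsmul ℝ ℝ)).integral f (lsmul ℝ ℝ) =
      μ.integral (fun x => g x * f x) (lsmul ℝ ℝ) := by
  have hiff := fun f => integrable_withDensity_lsmul_iff (f := f) hg hgm hg0
  -- The identity is checked on indicators, where it is the definition of the density, then extended
  -- by additivity, closedness in `L¹` and almost everywhere equality.
  refine MeasureTheory.Integrable.induction (fun f =>
    (μ.withDensity g (lsmul ℝ ℝ)).integral f (lsmul ℝ ℝ) =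
      μ.integral (fun x => g x * f x) (lsmul ℝ ℝ)) ?_ ?_ ?_ ?_ hf
  · intro c t ht htf
    have : IsFiniteMeasure ((μ.withDensity g (lsmul ℝ ℝ)).variation.restrict t) := ⟨by simpa⟩
    rw [VectorMeasure.integral_indicator_const _ ht, VectorMeasure.withDensity_apply hg,
      ← VectorMeasure.integral_indicator ht]
    simp only [lsmul_apply]
    rw [← VectorMeasure.integral_fun_smul]
    congr 1
    ext x
    by_cases hx : x ∈ t <;> simp [hx, mul_comm]
  · intro f₁ f₂ _ h₁ h₂ e₁ e₂
    simp only [Pi.add_apply, mul_add]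
    rw [VectorMeasure.integral_fun_add ((hiff _).1 h₁) ((hiff _).1 h₂), ← e₁, ← e₂]
    exact VectorMeasure.integral_fun_add h₁ h₂
  · refine isClosed_eq VectorMeasure.continuous_integral ?_
    -- The `L¹` distance for the weighted measure is the integral of `‖g‖ * ‖f₁ - f₂‖` against the
    -- variation of `μ`, so the right-hand side is Lipschitz in `f`.
    refine LipschitzWith.continuous (K := ‖(lsmul ℝ ℝ : ℝ →L[ℝ] F →L[ℝ] F)‖₊) fun f₁ f₂ => ?_
    refine (VectorMeasure.edist_integral_le_lintegral_edist
      ((hiff _).1 (L1.integrable_coeFn f₁)) ((hiff _).1 (L1.integrable_coeFn f₂))).trans ?_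
    have hl : ∀ h : X → ENNReal, ∫⁻ x, h x ∂(μ.withDensity g (lsmul ℝ ℝ)).variation =
        ∫⁻ x, ‖g x‖ₑ * h x ∂μ.variation := fun h => by
      rw [variation_withDensity_lsmul hg,
        lintegral_withDensity_eq_lintegral_mul_non_measurable _ hgm.enorm (by simp)]
      rfl
    rw [L1.edist_def, hl]
    refine le_of_eq ?_
    congr 1
    refine lintegral_congr fun x => ?_
    simp [edist_eq_enorm_sub, ← mul_sub, enorm_mul]
  · intro f₁ f₂ h12 h₁ e
    rw [← VectorMeasure.integral_congr_ae h12, e]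
    refine VectorMeasure.integral_congr_ae ?_
    rw [variation_withDensity_lsmul hg] at h12
    have := (ae_withDensity_iff hgm.enorm).1 h12
    filter_upwards [this] with x hx
    -- Almost everywhere equality for the weighted measure says nothing where `g` vanishes, but
    -- there both products are zero.
    by_cases h : g x = 0
    · simp [h]
    · rw [hx (by simpa using h)]

open ContinuousLinearMap in
theorem integral_simpleFunc_lsmul [CompleteSpace F] [IsFiniteMeasure μ.variation]
    (f : SimpleFunc X ℝ) :
    μ.integral f (lsmul ℝ ℝ) = ∑ c ∈ f.range, c • μ (f ⁻¹' {c}) := by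
  have h : (f : X → ℝ) = fun x => ∑ c ∈ f.range, (f ⁻¹' {c}).indicator (fun _ => c) x := by
    ext x
    rw [Finset.sum_eq_single (f x)]
    · simp
    · intro c _ hc
      exact Set.indicator_of_notMem (fun h => hc h.symm) _
    · intro h
      exact absurd (f.mem_range_self x) h
  conv_lhs => rw [h]
  rw [VectorMeasure.integral_finsetSum]
  · refine Finset.sum_congr rfl fun c _ => ?_
    rw [VectorMeasure.integral_indicator_const _ (f.measurableSet_fiber c)]
    rfl
  · exact fun c _ => (integrable_const c).indicator (f.measurableSet_fiber c)

open ContinuousLinearMap in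
-- Bridges two pairings: moments integrate real functions by scalar multiplication, matrix integrals
-- integrate complex functions by multiplication.
theorem integral_ofReal_mul {ν : VectorMeasure X ℂ} (hf : ν.Integrable f) (c : ℂ) :
    ν.integral (fun x => (f x : ℂ) * c) (ContinuousLinearMap.mul ℝ ℂ) =
      c * ν.integral f (lsmul ℝ ℝ) := by
  have h1 := VectorMeasure.integral_continuousLinearMap_comp (μ := ν)
    (B := ContinuousLinearMap.mul ℝ ℂ) (C := (ContinuousLinearMap.id ℝ ℝ).smulRight c) hf
  have h2 := VectorMeasure.continuousLinearMap_apply_integral (μ := ν)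
    (B := lsmul ℝ ℝ) (C := ContinuousLinearMap.mul ℝ ℂ c) hf
  simp only [ContinuousLinearMap.mul_apply'] at h2
  rw [h2]
  have h3 : (ContinuousLinearMap.mul ℝ ℂ) ∘L (ContinuousLinearMap.id ℝ ℝ).smulRight c =
      (compL ℝ ℂ ℂ ℂ (ContinuousLinearMap.mul ℝ ℂ c)) ∘L (lsmul ℝ ℝ : ℝ →L[ℝ] ℂ →L[ℝ] ℂ) := by
    ext
    simp
  rw [← h3, ← h1]
  simp

end VectorMeasureDensity

/-! ### Matrix integrals of polynomials -/

theorem sum_sum_comm_sum_sum {ι κ A : Type*} [AddCommMonoid A] (s : Finset ι) (u : Finset κ)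
    (f : ι → ι → κ → κ → A) :
    ∑ k ∈ s, ∑ l ∈ s, ∑ i ∈ u, ∑ j ∈ u, f k l i j =
      ∑ i ∈ u, ∑ j ∈ u, ∑ k ∈ s, ∑ l ∈ s, f k l i j :=
  calc
    _ = ∑ k ∈ s, ∑ i ∈ u, ∑ l ∈ s, ∑ j ∈ u, f k l i j :=
      Finset.sum_congr rfl fun _ _ => Finset.sum_comm
    _ = ∑ i ∈ u, ∑ k ∈ s, ∑ l ∈ s, ∑ j ∈ u, f k l i j := Finset.sum_comm
    _ = ∑ i ∈ u, ∑ k ∈ s, ∑ j ∈ u, ∑ l ∈ s, f k l i j :=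
      Finset.sum_congr rfl fun _ _ => Finset.sum_congr rfl fun _ _ => Finset.sum_comm
    _ = _ := Finset.sum_congr rfl fun _ _ => Finset.sum_comm

/-- Expanding both polynomials leaves integrals of the powers `x^{i+j}`, which are the moments
`t_{i+j}`; their combination is the Hankel form. -/
theorem hasMatrixIntegral_of_coeff {μ : VectorMeasure ℝ≥0 (Matrix (Fin q) (Fin q) ℂ)}
    {t : ℕ → Matrix (Fin q) (Fin q) ℂ} (hμ : IsMomentSolution μ t) (N : ℕ)
    (A B : ℕ → Matrix (Fin q) (Fin q) ℂ) {F G : ℝ≥0 → Matrix (Fin q) (Fin q) ℂ}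
    (hF : ∀ x, F x = ∑ i ∈ Finset.range N, ((x : ℝ) : ℂ) ^ i • A i)
    (hG : ∀ x, G x = ∑ i ∈ Finset.range N, ((x : ℝ) : ℂ) ^ i • B i) :
    HasMatrixIntegral F μ G (hankelForm t N A B) := by
  have hFG : ∀ a b k l x, star (F x k a) * G x l b =
      ∑ i ∈ Finset.range N, ∑ j ∈ Finset.range N,
        ((((x : ℝ) ^ (i + j) : ℝ) : ℂ) * (star (A i k a) * B j l b)) := fun a b k l x => by
    rw [hF, hG]
    simp only [Matrix.sum_apply, Matrix.smul_apply, smul_eq_mul, star_sum, star_mul', star_pow,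
      Finset.sum_mul_sum]
    refine Finset.sum_congr rfl fun i _ => Finset.sum_congr rfl fun j _ => ?_
    simp only [RCLike.star_def, Complex.conj_ofReal]
    push_cast
    ring
  have hint : ∀ k l i j (c : ℂ),
      (entry μ k l).Integrable fun x => (((x : ℝ) ^ (i + j) : ℝ) : ℂ) * c :=
    fun k l i j c => (((hμ.2 (i + j)).1 k l).ofReal).mul_const c
  refine ⟨fun a b k l => ?_, fun a b => ?_⟩
  · simp_rw [hFG]
    exact VectorMeasure.Integrable.fun_finsetSum _ fun i _ =>
      VectorMeasure.Integrable.fun_finsetSum _ fun j _ => hint _ _ _ _ _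
  · have hI : ∀ k l, (entry μ k l).integral (fun x => star (F x k a) * G x l b)
        (ContinuousLinearMap.mul ℝ ℂ) = ∑ i ∈ Finset.range N, ∑ j ∈ Finset.range N,
          star (A i k a) * t (i + j) k l * B j l b := fun k l => by
      simp_rw [hFG]
      rw [VectorMeasure.integral_finsetSum _ fun i _ =>
        VectorMeasure.Integrable.fun_finsetSum _ fun j _ => hint _ _ _ _ _]
      refine Finset.sum_congr rfl fun i _ => ?_
      rw [VectorMeasure.integral_finsetSum _ fun j _ => hint _ _ _ _ _]
      refine Finset.sum_congr rfl fun j _ => ?_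
      rw [integral_ofReal_mul ((hμ.2 (i + j)).1 k l), ← (hμ.2 (i + j)).2, moment, Matrix.of_apply]
      ring
    simp_rw [hI]
    rw [hankelForm_eq_sum]
    simp only [Finset.mul_sum, Matrix.sum_apply, ← Matrix.mul_assoc]
    simp_rw [Matrix.mul_apply, Finset.sum_mul, Matrix.conjTranspose_apply]
    rw [sum_sum_comm_sum_sum]
    refine Finset.sum_congr rfl fun i _ => Finset.sum_congr rfl fun j _ => ?_
    rw [Finset.sum_comm]

/-! ### The measure with density `t` -/

theorem posSemidef_of_tendsto {ι : Type*} {l : Filter ι} [l.NeBot]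
    {A : ι → Matrix (Fin q) (Fin q) ℂ} {B : Matrix (Fin q) (Fin q) ℂ}
    (h : Filter.Tendsto A l (nhds B)) (hA : ∀ i, (A i).PosSemidef) : B.PosSemidef := by
  refine Matrix.PosSemidef.of_dotProduct_mulVec_nonneg ?_ fun x => ?_
  · refine tendsto_nhds_unique (h.star) ?_
    simpa [Matrix.star_eq_conjTranspose, (hA _).isHermitian.eq] using h
  · have hc : Continuous fun M : Matrix (Fin q) (Fin q) ℂ => star x ⬝ᵥ M.mulVec x := by fun_prop
    exact ge_of_tendsto' ((hc.tendsto B).comp h) fun i => (hA i).dotProduct_mulVec_nonneg x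

theorem entry_apply (μ : VectorMeasure ℝ≥0 (Matrix (Fin q) (Fin q) ℂ)) (k l : Fin q)
    (B : Set ℝ≥0) : entry μ k l B = μ B k l :=
  VectorMeasure.mapRange_apply ..

/-- For a nonnegative simple function the integral is a nonnegative combination of values of `μ`.
The general case is an entrywise limit, and positive semidefinite matrices form a closed set. -/
theorem IsNonnegHermitian.posSemidef_integral
    {μ : VectorMeasure ℝ≥0 (Matrix (Fin q) (Fin q) ℂ)} (hμ : IsNonnegHermitian μ)
    (hfin : ∀ k l, IsFiniteMeasure (entry μ k l).variation) {f : ℝ≥0 → ℝ}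
    (hfm : Measurable f) (hf0 : ∀ x, 0 ≤ f x) (hf : ∀ k l, (entry μ k l).Integrable f) :
    (Matrix.of fun k l => (entry μ k l).integral f
      (ContinuousLinearMap.lsmul ℝ ℝ)).PosSemidef := by
  let g : ℕ → SimpleFunc ℝ≥0 ℝ := SimpleFunc.approxOn f hfm (Set.Ici 0) 0 Set.self_mem_Ici
  have hg : ∀ n, (Matrix.of fun k l => (entry μ k l).integral (g n)
      (ContinuousLinearMap.lsmul ℝ ℝ)).PosSemidef := fun n => by
    have h : (Matrix.of fun k l => (entry μ k l).integral (g n)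
        (ContinuousLinearMap.lsmul ℝ ℝ)) = ∑ c ∈ (g n).range, c • μ (g n ⁻¹' {c}) := by
      ext k l
      rw [Matrix.of_apply, integral_simpleFunc_lsmul]
      simp [Matrix.sum_apply, entry_apply]
    rw [h]
    refine Matrix.posSemidef_sum _ fun c hc => ?_
    obtain ⟨x, rfl⟩ := SimpleFunc.mem_range.1 hc
    exact (hμ _ ((g n).measurableSet_fiber _)).smul
      (SimpleFunc.approxOn_mem hfm Set.self_mem_Ici n x)
  refine posSemidef_of_tendsto (l := Filter.atTop) ?_ hg
  refine tendsto_pi_nhds.2 fun k => tendsto_pi_nhds.2 fun l => ?_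
  -- Approximation inside `[0, ∞)` starting from `0` gives the bound `2‖f‖` for every approximant.
  refine VectorMeasure.tendsto_integral_of_dominated_convergence (fun x => ‖f x‖ + ‖f x‖)
    (fun n => (g n).aestronglyMeasurable) ((hf k l).norm.add (hf k l).norm) (fun n => ?_) ?_
  · exact Filter.Eventually.of_forall fun x =>
      SimpleFunc.norm_approxOn_zero_le hfm Set.self_mem_Ici x n
  · exact Filter.Eventually.of_forall fun x =>
      SimpleFunc.tendsto_approxOn hfm Set.self_mem_Ici (subset_closure (hf0 x))

theorem entry_tWeighted (μ : VectorMeasure ℝ≥0 (Matrix (Fin q) (Fin q) ℂ)) (k l : Fin q) :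
    entry (tWeighted μ) k l = (entry μ k l).withDensity (fun t : ℝ≥0 => (t : ℝ))
      (ContinuousLinearMap.lsmul ℝ ℝ) := by
  ext B _
  rw [entry_apply]
  rfl

theorem IsMomentSolution.tWeighted {μ : VectorMeasure ℝ≥0 (Matrix (Fin q) (Fin q) ℂ)}
    {t : ℕ → Matrix (Fin q) (Fin q) ℂ} (hμ : IsMomentSolution μ t) :
    IsMomentSolution (tWeighted μ) (shift t) := by
  have h1 : ∀ k l, (entry μ k l).Integrable fun x : ℝ≥0 => (x : ℝ) := fun k l => by
    simpa using (hμ.2 1).1 k l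
  -- Existence of the zeroth moment means that the constant `1` is integrable, so every entry has
  -- finite variation.
  have hfin : ∀ k l, IsFiniteMeasure (entry μ k l).variation := fun k l => by
    have h := (hμ.2 0).1 k l
    simp only [pow_zero] at h
    exact (integrable_const_iff_isFiniteMeasure one_ne_zero).1 h
  have hm : Measurable fun x : ℝ≥0 => (x : ℝ) := NNReal.continuous_coe.measurable
  have h0 : ∀ x : ℝ≥0, 0 ≤ (x : ℝ) := NNReal.coe_nonneg
  refine ⟨fun B hB => ?_, fun j => ?_⟩
  · have h := hμ.1.posSemidef_integral hfin (hm.indicator hB)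
      (fun x => Set.indicator_nonneg (fun x _ => h0 x) x)
      (fun k l => (h1 k l).indicator hB)
    convert h using 1
    ext k l
    rw [tWeighted_apply μ h1, Matrix.of_apply, VectorMeasure.integral_indicator hB]
  · have hint : ∀ k l, (entry (StieltjesMoment.tWeighted μ) k l).Integrable
        fun x : ℝ≥0 => (x : ℝ) ^ j := fun k l => by
      rw [entry_tWeighted, integrable_withDensity_lsmul_iff (h1 k l) hm h0]
      simpa only [← pow_succ'] using (hμ.2 (j + 1)).1 k l
    refine ⟨hint, ?_⟩
    rw [shift, ← (hμ.2 (j + 1)).2]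
    ext k l
    have h := hint k l
    rw [entry_tWeighted] at h
    simp only [moment, Matrix.of_apply]
    rw [entry_tWeighted, integral_withDensity_lsmul (h1 k l) hm h0 h]
    simp only [← pow_succ']

end StieltjesMoment

end

open StieltjesMoment

theorem mainTheorem4 (q : ℕ) (hq : 0 < q) (s : ℕ → Matrix (Fin q) (Fin q) ℂ)
    (hs : StieltjesMoment.IsStieltjesPosDef s) :
    StieltjesMoment.IsStieltjesPosDef (StieltjesMoment.firstTransform s) ∧
    StieltjesMoment.IsStieltjesPosDef (StieltjesMoment.shift (StieltjesMoment.firstTransform s)) ∧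
    StieltjesMoment.IsMonicRightOrthogonalSystem (StieltjesMoment.firstTransform s)
      (fun k z => (s 0)⁻¹ * StieltjesMoment.polyQSharp s k z) ∧
    StieltjesMoment.IsMonicRightOrthogonalSystem
      (StieltjesMoment.shift (StieltjesMoment.firstTransform s))
      (fun k z => (s 0)⁻¹ * StieltjesMoment.polyQ s (k + 1) z) ∧
    ∀ μ : MeasureTheory.VectorMeasure ℝ≥0 (Matrix (Fin q) (Fin q) ℂ),
      StieltjesMoment.IsMomentSolution μ (StieltjesMoment.firstTransform s) →
      (∀ m n : ℕ, StieltjesMoment.HasMatrixIntegral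
        (fun t => (s 0)⁻¹ * StieltjesMoment.polyQSharp s m ((t : ℝ) : ℂ)) μ
        (fun t => (s 0)⁻¹ * StieltjesMoment.polyQSharp s n ((t : ℝ) : ℂ))
        (if m = n then StieltjesMoment.schurK s n else 0)) ∧
      StieltjesMoment.IsMomentSolution (StieltjesMoment.tWeighted μ)
        (StieltjesMoment.shift (StieltjesMoment.firstTransform s)) ∧
      (∀ m n : ℕ, (m ≠ 0 ∨ n ≠ 0) → StieltjesMoment.HasMatrixIntegral
        (fun t => (s 0)⁻¹ * StieltjesMoment.polyQ s m ((t : ℝ) : ℂ))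
        (StieltjesMoment.tWeighted μ)
        (fun t => (s 0)⁻¹ * StieltjesMoment.polyQ s n ((t : ℝ) : ℂ))
        (if m = n then StieltjesMoment.schurH s n else 0)) := by
  -- Zero padding lets polynomials of different degrees be summed over one common range, as the
  -- Hankel form requires.
  have hF : ∀ {n N : ℕ} {p : ℕ → ℕ → Matrix (Fin q) (Fin q) ℂ}, n < N → (∀ i, n < i → p n i = 0) →
      ∀ z : ℂ, ∑ i ∈ Finset.range (n + 1), z ^ i • p n i =
        ∑ i ∈ Finset.range N, z ^ i • p n i := fun hn hp z =>
    Finset.sum_subset (Finset.range_subset_range.2 hn) fun i _ hi => by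
      rw [hp i (by simpa using hi), smul_zero]
  refine ⟨hs.firstTransform, hs.firstTransform.shift, ?_, ?_, fun μ hμ => ⟨fun m n => ?_,
    hμ.tWeighted, fun m n hmn => ?_⟩⟩
  · refine isMonicRightOrthogonalSystem_of_coeff hq (sharpCoeff s) (polyQSharp_eq_sum hs)
      (sharpCoeff_self hs.isUnit_det) (fun _ _ => sharpCoeff_of_lt s) fun j k hjk => ?_
    rw [hankelForm_sharpCoeff hs (by omega) (by omega), if_neg hjk]
  · refine isMonicRightOrthogonalSystem_of_coeff hq (fun k => secondCoeff s (k + 1))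
      (fun k z => ?_) (secondCoeff_succ_self hs.isUnit_det) (fun _ _ => secondCoeff_of_le s)
      fun j k hjk => ?_
    -- The expansion of `Q_{k+1}` is written up to `z^{k+1}`, but its degree is only `k`: the top
    -- coefficient is zero.
    · rw [polyQ_eq_sum hs, Finset.sum_range_succ, secondCoeff_of_le s le_rfl, smul_zero, add_zero]
    · rw [hankelForm_secondCoeff hs (by omega) (by omega) (by omega), if_neg (by omega)]
  · rw [← hankelForm_sharpCoeff hs (N := max m n + 1) (by omega) (by omega)]
    exact hasMatrixIntegral_of_coeff hμ _ _ _
      (fun x => by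
        rw [polyQSharp_eq_sum hs, hF (N := max m n + 1) (by omega) fun _ => sharpCoeff_of_lt s])
      (fun x => by
        rw [polyQSharp_eq_sum hs, hF (N := max m n + 1) (by omega) fun _ => sharpCoeff_of_lt s])
  · rw [← hankelForm_secondCoeff hs (N := max m n + 1) (by omega) (by omega) hmn]
    exact hasMatrixIntegral_of_coeff hμ.tWeighted _ _ _
      (fun x => by
        rw [polyQ_eq_sum hs, hF (N := max m n + 1) (by omega) fun _ h => secondCoeff_of_le s h.le])
      (fun x => by
        rw [polyQ_eq_sum hs, hF (N := max m n + 1) (by omega) fun _ h => secondCoeff_of_le s h.le])
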